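/- Consider $N$ parallel queues and $K$ identical servers in slotted time $t=1,2,\dots$. Let $C_{n,k}(t)\in\{0,1\}$ be the connectivity of queue $n$ to server $k$ in slot $t$ and $A_n(t)\in\{0,1\}$ the number of packets arriving to queue $n$ at the end of slot $t$. The variables $C_{n,k}(t)$ are i.i.d. Bernoulli with parameter $p$, the variables $A_n(t)$ are i.i.d. Bernoulli with parameter $\lambda$, the connectivities and arrivals are mutually independent, and they are independent of the initial queue length vector $X(0)\in\mathbb{Z}_+^N$, whose law is arbitrary. A matching is an $N\times K$ matrix with entries in $\{0,1\}$ all of whose row sums and column sums are at most $1$. A (server-assignment) policy $\pi$ chooses in every slot $t$ a matching $M^{(\pi)}(t)$ causally, that is, as a function of $X(0)$, of the connectivities of slots $1,\dots,t$, of the arrivals of slots $1,\dots,t-1$, and of a private random seed $U$, independent of $X(0)$ and of all connectivities and arrivals, with values in a fixed measurable space $S$ (if $S$ has one point, the policies are the nonrandomized ones). The queue lengths under $\pi$ evolve by $$X_n(t)=\Bigl(X_n(t-1)-\sum_{k=1}^K C_{n,k}(t)M^{(\pi)}_{n,k}(t)\Bigr)^+ + A_n(t),\qquad n=1,\dots,N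 .$$ A policy is an MWM (maximum weighted matching) policy if in every slot $t$, along every sample path, $M^{(\pi)}(t)$ maximizes $\sum_{n} X_n(t-1)\sum_{k} M_{n,k}C_{n,k}(t)$ over all matchings $M$. For $\tilde x,x\in\mathbb{Z}_+^N$ write $\tilde x\preceq x$ if (D1) $\tilde x_n\le x_n$ for all $n$; or (D2) $\tilde x$ is obtained from $x$ by exchanging two of its entries; or (D3) $\tilde x$ and $x$ differ in exactly two entries $n,m$, with $x_n<\tilde x_n\le\tilde x_m<x_m$, $\tilde x_n=x_n+1$ and $\tilde x_m=x_m-1$. Let $\preceq_p$ be the transitive closure of $\preceq$, and let $\mathcal F$ be the class of all $f:\mathbb{Z}_+^N\to\mathbb{R}$ such that $\tilde x\preceq_p x$ implies $f(\tilde x)\le f(x)$. A policy $\tilde\pi$ with queue length process $\tilde X$ dominates a policy $\pi$ with queue length process $X$ if $\Pr(f(\tilde X(t))>r)\le\Pr(f(X(t))>r)$ for all $f\in\mathcal F$, all $t=1,2,\dots$ and all $r\in\mathbb{R}$. Theorem. For any server-assignment policy $\pi$ that is not an MWM policy, there is an MWM policy $\pi^*$ that dominates $\pi$. (Both policies use the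 same seed $U$; in particular, for one-point $S$ both are nonrandomized.) -/

import Mathlib

open MeasureTheory ProbabilityTheory

/-- A matching between `N` queues and `K` servers: an `N × K` matrix with entries in `{0, 1}`
all of whose row sums and column sums are at most `1`. -/
structure Matching (N K : ℕ) where
  /-- the indicator variables `M n k` -/
  toMat : Fin N → Fin K → ℕ
  zero_or_one : ∀ n k, toMat n k = 0 ∨ toMat n k = 1
  row_sum_le : ∀ n, ∑ k, toMat n k ≤ 1
  col_sum_le : ∀ k, ∑ n, toMat n k ≤ 1

/-- A causal server assignment policy. Time slots are numbered `0, 1, 2, …`.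
The matching employed in slot `t` depends on the initial queue lengths `x₀`, on the connectivities
`c 0, …, c t`, on the arrivals `a 0, …, a (t - 1)` (the arrivals of slot `t` come at the end of the
slot), and on the value `s` of a private random seed. These data determine all the earlier queue
lengths, matchings and services. For a one-point seed space `S` these are exactly the
nonrandomized causal policies. -/
structure Policy (N K : ℕ) (S : Type*) [MeasurableSpace S] where
  /-- the matching employed in slot `t`, along the sample path `(s, x₀, c, a)` -/
  matching : (t : ℕ) → (s : S) → (x₀ : Fin N → ℕ) → (c : ℕ → Fin N → Fin K → Bool) →
    (a : ℕ → Fin N → Bool) → Matching N K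
  causal : ∀ t s x₀ c c' a a', (∀ i ≤ t, c i = c' i) → (∀ i < t, a i = a' i) →
    matching t s x₀ c a = matching t s x₀ c' a'
  measurable_seed : ∀ t x₀ c a M, MeasurableSet {s | matching t s x₀ c a = M}

namespace Policy

variable {N K : ℕ} {S : Type*} [MeasurableSpace S]

/-- Queue lengths under the policy along the sample path `(s, x₀, c, a)`: `queue 0` is the initial
vector, and `queue (t + 1)` is the vector at the end of slot `t`. The subtraction is the truncated
one of `ℕ`, that is, the positive part of the difference. -/
def queue (π : Policy N K S) (s : S) (x₀ : Fin N → ℕ) (c : ℕ → Fin N → Fin K → Bool)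
    (a : ℕ → Fin N → Bool) : ℕ → Fin N → ℕ
  | 0 => x₀
  | t + 1 => fun n =>
      (π.queue s x₀ c a t n - ∑ k, (c t n k).toNat * (π.matching t s x₀ c a).toMat n k)
        + (a t n).toNat

end Policy

/-- The weight of a matching, for queue lengths `x` and connectivities `c`. -/
def matchingWeight {N K : ℕ} (x : Fin N → ℕ) (c : Fin N → Fin K → Bool) (M : Matching N K) : ℕ :=
  ∑ n, x n * ∑ k, M.toMat n k * (c n k).toNat

/-- `M` is a maximum weighted matching for queue lengths `x` and connectivities `c`. -/
def IsMaxWeightMatching {N K : ℕ} (x : Fin N → ℕ) (c : Fin N → Fin K → Bool)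
    (M : Matching N K) : Prop :=
  ∀ M' : Matching N K, matchingWeight x c M' ≤ matchingWeight x c M

/-- A policy is MWM if it employs a maximum weighted matching in every time slot, along every
sample path. -/
def Policy.IsMWM {N K : ℕ} {S : Type*} [MeasurableSpace S] (π : Policy N K S) : Prop :=
  ∀ s x₀ c a t, IsMaxWeightMatching (π.queue s x₀ c a t) (c t) (π.matching t s x₀ c a)

/-- The relation `y ⪯ x` on vectors of nonnegative integers: `y` is componentwise at most `x`, or
`y` arises from `x` by exchanging two entries, or `y` arises from `x` by a balancing
interchange. -/
def BalLE {N : ℕ} (y x : Fin N → ℕ) : Prop :=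
  (∀ n, y n ≤ x n) ∨
  (∃ n m, n ≠ m ∧ y n = x m ∧ y m = x n ∧ ∀ i, i ≠ n → i ≠ m → y i = x i) ∨
  (∃ n m, n ≠ m ∧ x n < y n ∧ y n ≤ y m ∧ y m < x m ∧ y n = x n + 1 ∧ x m = y m + 1 ∧
    ∀ i, i ≠ n → i ≠ m → y i = x i)

/-- The order `⪯ₚ`, the transitive closure of `⪯`. -/
def BalOrder {N : ℕ} : (Fin N → ℕ) → (Fin N → ℕ) → Prop :=
  Relation.TransGen BalLE

/-- The class of cost functions: real functions that are nondecreasing with respect to `⪯ₚ`. -/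
def costFunctions (N : ℕ) : Set ((Fin N → ℕ) → ℝ) :=
  {f | ∀ y x, BalOrder y x → f y ≤ f x}

/-- `Y ≤ₛₜ Z` for real-valued discrete-time processes. -/
def StochLE {Ω : Type*} [MeasurableSpace Ω] (P : Measure Ω) (Y Z : ℕ → Ω → ℝ) : Prop :=
  ∀ (t : ℕ) (r : ℝ), P {ω | r < Y t ω} ≤ P {ω | r < Z t ω}

/-- The probabilistic assumptions: the connectivities `C t n k` are i.i.d. Bernoulli with
parameter `p`, the arrivals `A t n` are i.i.d. Bernoulli with parameter `lam`, connectivities and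
arrivals are mutually independent, and the initial queue lengths `X₀` (with an arbitrary law) and
the private seed `U` are independent of each other and of all connectivities and arrivals. -/
structure IsQueueingModel {Ω S : Type*} [MeasurableSpace Ω] [MeasurableSpace S] {N K : ℕ}
    (P : Measure Ω) (p lam : ℝ) (X₀ : Ω → Fin N → ℕ) (C : ℕ → Fin N → Fin K → Ω → Bool)
    (A : ℕ → Fin N → Ω → Bool) (U : Ω → S) : Prop where
  measurable_X₀ : Measurable X₀
  measurable_C : ∀ t n k, Measurable (C t n k)
  measurable_A : ∀ t n, Measurable (A t n)
  measurable_U : Measurable U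
  prob_C : ∀ t n k, P.real {ω | C t n k ω = true} = p
  prob_A : ∀ t n, P.real {ω | A t n ω = true} = lam
  indep_C_A : iIndepFun (fun i : (ℕ × Fin N × Fin K) ⊕ (ℕ × Fin N) =>
    Sum.elim (fun j => C j.1 j.2.1 j.2.2) (fun j => A j.1 j.2) i) P
  indep_X₀_U : IndepFun X₀ U P
  indep_init : IndepFun (fun ω => (X₀ ω, U ω))
    (fun ω => (fun t n k => C t n k ω, fun t n => A t n ω) :
      Ω → (ℕ → Fin N → Fin K → Bool) × (ℕ → Fin N → Bool)) P

/-- The random queue length vector at time `t` (initial vector for `t = 0`, end of the `t`-th slot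
for `t = 1, 2, …`) under the policy `π`. -/
def Policy.randomQueue {Ω S : Type*} [MeasurableSpace S] {N K : ℕ} (π : Policy N K S)
    (X₀ : Ω → Fin N → ℕ) (C : ℕ → Fin N → Fin K → Ω → Bool) (A : ℕ → Fin N → Ω → Bool)
    (U : Ω → S) (t : ℕ) (ω : Ω) : Fin N → ℕ :=
  π.queue (U ω) (X₀ ω) (fun i n k => C i n k ω) (fun i n => A i n ω) t

/-- `π'` dominates `π`: for every cost function `f`, the process `f (X'(t))`, `t = 1, 2, …`, under
`π'` is stochastically smaller than the process `f (X(t))`, `t = 1, 2, …`, under `π`. -/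
def Policy.Dominates {Ω S : Type*} [MeasurableSpace Ω] [MeasurableSpace S] {N K : ℕ}
    (P : Measure Ω) (X₀ : Ω → Fin N → ℕ) (C : ℕ → Fin N → Fin K → Ω → Bool)
    (A : ℕ → Fin N → Ω → Bool) (U : Ω → S) (π' π : Policy N K S) : Prop :=
  ∀ f ∈ costFunctions N,
    StochLE P (fun t ω => f (π'.randomQueue X₀ C A U (t + 1) ω))
      (fun t ω => f (π.randomQueue X₀ C A U (t + 1) ω))

/-! ### Matroid exchange for matchable sets. -/

section Exchange

variable {α β : Type*}

/-! The sets of queues that can be served in one slot are the independent sets of a transversal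
matroid. Hence a served set of maximum weight contains, above each positive length threshold, at
least as many queues as any rival (`Matchable.card_filter_le_of_isMax`). The rival's services can
then be moved one by one to queues at least as long until all its nonempty queues lie in the optimal
set; each move is an exchange of entries or a balancing interchange (`balOrder_serve`). So from a
common state, an MWM matching leaves a vector that is lowest for `⪯ₚ`
(`IsMaxWeightMatching.balOrder`).

The rest is dynamic programming. Averaging a monotone cost over arrivals, or over connectivities
with MWM service, gives a monotone cost again (`BalMono.arrivalMean`, `BalMono.serviceMean`).
Peeling off the last slot therefore gives an induction on the horizon, carried out for all monotone
costs at once (`lintegral_maxWeight_le`). Indicators of `{r < f}` turn this into stochastic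
dominance. A single MWM policy, which ignores the seed, works against every competitor. -/

/-- The vertices of `S` can be matched along `R` to distinct partners. -/
def Matchable (R : α → β → Prop) (S : Finset α) : Prop :=
  ∃ f : α → β, Set.InjOn f S ∧ ∀ a ∈ S, R a (f a)

theorem Matchable.mono {R : α → β → Prop} {S T : Finset α} (hT : Matchable R T) (h : S ⊆ T) :
    Matchable R S := by
  obtain ⟨f, hf, hR⟩ := hT
  exact ⟨f, hf.mono (by exact_mod_cast h), fun a ha => hR a (h ha)⟩

/-- Augmentation axiom of the transversal matroid. In place of augmenting paths, the matching of `S`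
is made to agree with that of `T` on more and more elements until a partner used by `T` becomes free
for a new element. -/
theorem Matchable.augment [DecidableEq α] {R : α → β → Prop} {S T : Finset α} (hS : Matchable R S)
    (hT : Matchable R T) (hcard : S.card < T.card) :
    ∃ b ∈ T, b ∉ S ∧ Matchable R (insert b S) := by
  classical
  obtain ⟨f, hf, hfR⟩ := hS
  obtain ⟨g, hg, hgR⟩ := hT
  induction h : (S.filter fun a => f a ≠ g a).card using Nat.strong_induction_on generalizing f with
  | _ d ih =>
    obtain ⟨y, hyT, hyS⟩ : ∃ y ∈ T.image g, y ∉ S.image f := by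
      refine Finset.exists_mem_notMem_of_card_lt_card ?_
      rw [Finset.card_image_of_injOn hf, Finset.card_image_of_injOn hg]
      exact hcard
    obtain ⟨b, hb, rfl⟩ := Finset.mem_image.1 hyT
    have hne : ∀ a ∈ S, f a ≠ g b := fun a ha he => hyS (Finset.mem_image.2 ⟨a, ha, he⟩)
    have hinj : ∀ S' : Finset α, (∀ a ∈ S', a = b ∨ a ∈ S) →
        Set.InjOn (Function.update f b (g b)) S' := by
      intro S' hS' a ha a' ha' he
      by_cases hab : a = b <;> by_cases hab' : a' = b
      · rw [hab, hab']
      · subst hab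
        rw [Function.update_self, Function.update_of_ne hab'] at he
        exact absurd he.symm (hne a' ((hS' a' ha').resolve_left hab'))
      · subst hab'
        rw [Function.update_self, Function.update_of_ne hab] at he
        exact absurd he (hne a ((hS' a ha).resolve_left hab))
      · rw [Function.update_of_ne hab, Function.update_of_ne hab'] at he
        exact hf ((hS' a ha).resolve_left hab) ((hS' a' ha').resolve_left hab') he
    have hR : ∀ a, a = b ∨ a ∈ S → R a (Function.update f b (g b) a) := by
      intro a ha
      by_cases hab : a = b
      · subst hab
        rw [Function.update_self]
        exact hgR a hb
      · rw [Function.update_of_ne hab]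
        exact hfR a (ha.resolve_left hab)
    by_cases hbS : b ∈ S
    -- The partner `g b` is free, so `b` can be moved to it; this removes `b` from the disagreements
    -- and creates none.
    · refine ih _ ?_ (Function.update f b (g b)) (hinj S fun a ha => Or.inr ha)
        (fun a ha => hR a (Or.inr ha)) rfl
      rw [← h]
      refine Finset.card_lt_card (Finset.ssubset_iff_of_subset ?_ |>.2
        ⟨b, Finset.mem_filter.2 ⟨hbS, hne b hbS⟩, by simp⟩)
      intro a ha
      rw [Finset.mem_filter] at ha ⊢
      refine ⟨ha.1, fun he => ha.2 ?_⟩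
      by_cases hab : a = b
      · rw [hab, Function.update_self]
      · rw [Function.update_of_ne hab, he]
    · exact ⟨b, hb, hbS, _, hinj _ fun a ha => Finset.mem_insert.1 ha,
        fun a ha => hR a (Finset.mem_insert.1 ha)⟩

theorem Matchable.exists_extension [DecidableEq α] {R : α → β → Prop} {S T : Finset α} (hS : Matchable R S)
    (hT : Matchable R T) :
    ∃ J, S ⊆ J ∧ J ⊆ S ∪ T ∧ T.card ≤ J.card ∧ Matchable R J := by
  induction h : T.card - S.card generalizing S with
  | zero => exact ⟨S, subset_rfl, Finset.subset_union_left, by omega, hS⟩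
  | succ d ih =>
    obtain ⟨b, hbT, hbS, hb⟩ := hS.augment hT (by omega)
    obtain ⟨J, h1, h2, h3, h4⟩ := ih hb (by rw [Finset.card_insert_of_notMem hbS]; omega)
    refine ⟨J, (Finset.subset_insert b S).trans h1, h2.trans ?_, h3, h4⟩
    intro a ha
    rw [Finset.mem_union, Finset.mem_insert] at ha
    rw [Finset.mem_union]
    rcases ha with (rfl | ha) | ha
    · exact Or.inr hbT
    · exact Or.inl ha
    · exact Or.inr ha

/-- A matchable set of maximum weight contains, above every positive threshold, at least as many
elements as any other matchable set. -/
theorem Matchable.card_filter_le_of_isMax {R : α → β → Prop} {S I : Finset α} {x : α → ℕ}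
    (hS : Matchable R S) (hmax : ∀ J, Matchable R J → ∑ n ∈ J, x n ≤ ∑ n ∈ S, x n)
    (hI : Matchable R I) {v : ℕ} (hv : 1 ≤ v) :
    (I.filter fun n => v ≤ x n).card ≤ (S.filter fun n => v ≤ x n).card := by
  classical
  by_contra! hlt
  obtain ⟨j, hjI, hjS, hj⟩ := (hS.mono (Finset.filter_subset _ S)).augment
    (hI.mono (Finset.filter_subset _ I)) hlt
  have hjv : v ≤ x j := (Finset.mem_filter.1 hjI).2
  have hjS' : j ∉ S := fun h => hjS (Finset.mem_filter.2 ⟨h, hjv⟩)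
  -- `J` keeps `j` and all heavy elements of `S`, and omits at most one light element: an exchange
  -- that increases the weight.
  obtain ⟨J, hJ1, hJ2, hJ3, hJ⟩ := hj.exists_extension hS
  have hJsub : J ⊆ insert j S := by
    refine hJ2.trans ?_
    intro a ha
    simp only [Finset.mem_union, Finset.mem_insert, Finset.mem_filter] at ha ⊢
    tauto
  have hcard : (insert j S \ J).card ≤ 1 := by
    rw [Finset.card_sdiff_of_subset hJsub, Finset.card_insert_of_notMem hjS']
    omega
  -- The omitted set may be empty; then the strict inequality is `0 < v`.
  have hsum : ∑ n ∈ insert j S \ J, x n < v := by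
    have hsmall : ∀ n ∈ insert j S \ J, x n < v := by
      intro n hn
      rw [Finset.mem_sdiff, Finset.mem_insert] at hn
      by_contra! hvn
      refine hn.2 (hJ1 ?_)
      rw [Finset.mem_insert, Finset.mem_filter]
      exact hn.1.imp_right fun h => ⟨h, hvn⟩
    have hle : ∑ n ∈ insert j S \ J, x n ≤ (insert j S \ J).card * (v - 1) :=
      Finset.sum_le_card_nsmul _ x (v - 1) fun n hn => Nat.le_sub_one_of_lt (hsmall n hn)
    have := Nat.mul_le_mul_right (v - 1) hcard
    omega
  have h1 := Finset.sum_sdiff (f := x) hJsub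
  rw [Finset.sum_insert hjS'] at h1
  have h2 := hmax J hJ
  omega

end Exchange

/-! ### From threshold counts to the order `⪯ₚ`. -/

section Order

variable {N : ℕ}

/-- The queue lengths after one customer has been served in each nonempty queue of `I`. -/
def serve (x : Fin N → ℕ) (I : Finset (Fin N)) : Fin N → ℕ :=
  fun n => x n - if n ∈ I then 1 else 0

theorem balLE_serve_exchange {x : Fin N → ℕ} {I : Finset (Fin N)} {i s : Fin N} (hi : i ∈ I)
    (hs : s ∉ I) (hpos : 1 ≤ x i) (hle : x i ≤ x s) :
    BalLE (serve x (insert s (I.erase i))) (serve x I) := by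
  have his : i ≠ s := fun h => hs (h ▸ hi)
  have e1 : serve x (insert s (I.erase i)) i = x i := by simp [serve, his]
  have e2 : serve x (insert s (I.erase i)) s = x s - 1 := by simp [serve]
  have e3 : serve x I i = x i - 1 := by simp [serve, hi]
  have e4 : serve x I s = x s := by simp [serve, hs]
  have e5 : ∀ j, j ≠ i → j ≠ s → serve x (insert s (I.erase i)) j = serve x I j := by
    intro j hji hjs
    simp [serve, hji, hjs]
  rcases hle.eq_or_lt with heq | hlt
  · exact Or.inr (Or.inl ⟨i, s, his, by rw [e1, e4, heq], by rw [e2, e3, heq], e5⟩)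
  · exact Or.inr (Or.inr ⟨i, s, his, by omega, by omega, by omega, by omega, by omega, e5⟩)

theorem balOrder_serve {x : Fin N → ℕ} {S I : Finset (Fin N)}
    (h : ∀ v, 1 ≤ v →
      (I.filter fun n => v ≤ x n).card ≤ (S.filter fun n => v ≤ x n).card) :
    BalOrder (serve x S) (serve x I) := by
  induction hd : ((I \ S).filter fun n => 1 ≤ x n).card generalizing I with
  | zero =>
    refine Relation.TransGen.single (Or.inl fun n => ?_)
    have hn : n ∉ (I \ S).filter fun n => 1 ≤ x n := by
      rw [Finset.card_eq_zero.1 hd]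
      exact Finset.notMem_empty n
    rw [Finset.mem_filter, Finset.mem_sdiff] at hn
    unfold serve
    split_ifs <;> first | omega | (exfalso; tauto) | skip
    have : ¬ 1 ≤ x n := by tauto
    omega
  | succ d ih =>
    -- A longest queue of `I \ S` is replaced, so that above its length `I` already lies in `S` and
    -- the threshold inequalities survive.
    obtain ⟨i, hi, hmax⟩ := Finset.exists_max_image ((I \ S).filter fun n => 1 ≤ x n) x
      (Finset.card_pos.1 (by omega))
    obtain ⟨hiIS, hpos⟩ := Finset.mem_filter.1 hi
    obtain ⟨hiI, hiS⟩ := Finset.mem_sdiff.1 hiIS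
    obtain ⟨s, hsS, hsI⟩ : ∃ s ∈ S.filter (fun n => x i ≤ x n),
        s ∉ I.filter (fun n => x i ≤ x n) := by
      by_contra! hsub
      have hss : S.filter (fun n => x i ≤ x n) ⊂ I.filter (fun n => x i ≤ x n) :=
        (Finset.ssubset_iff_of_subset hsub).2 ⟨i, by simp [hiI], by simp [hiS]⟩
      exact absurd (Finset.card_lt_card hss) (h (x i) hpos).not_gt
    rw [Finset.mem_filter] at hsS hsI
    have hsI' : s ∉ I := fun h => hsI ⟨h, hsS.2⟩
    have his : i ≠ s := fun h => hiS (h ▸ hsS.1)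
    refine Relation.TransGen.tail (ih (I := insert s (I.erase i)) ?_ ?_)
      (balLE_serve_exchange hiI hsI' hpos hsS.2)
    · intro v hv
      by_cases hvi : v ≤ x i
      · refine le_trans (le_of_eq ?_) (h v hv)
        rw [Finset.filter_insert, if_pos (hvi.trans hsS.2), Finset.filter_erase,
          Finset.card_insert_of_notMem (by simp [hsI']), Finset.card_erase_add_one]
        simp [hiI, hvi]
      · refine Finset.card_le_card fun n hn => ?_
        rw [Finset.mem_filter, Finset.mem_insert, Finset.mem_erase] at hn
        rw [Finset.mem_filter]
        refine ⟨?_, hn.2⟩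
        rcases hn.1 with rfl | ⟨_, hnI⟩
        · exact hsS.1
        · by_contra hnS
          have := hmax n (by simp [hnI, hnS]; omega)
          omega
    · have : ((insert s (I.erase i)) \ S).filter (fun n => 1 ≤ x n)
          = ((I \ S).filter fun n => 1 ≤ x n).erase i := by
        ext n
        simp only [Finset.mem_filter, Finset.mem_sdiff, Finset.mem_insert, Finset.mem_erase]
        constructor
        · rintro ⟨⟨rfl | h1, h2⟩, h3⟩
          · exact absurd hsS.1 h2
          · exact ⟨h1.1, ⟨h1.2, h2⟩, h3⟩
        · rintro ⟨h1, ⟨h2, h3⟩, h4⟩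
          exact ⟨⟨Or.inr ⟨h1, h2⟩, h3⟩, h4⟩
      rw [this, Finset.card_erase_of_mem hi, hd]
      rfl

end Order

/-! ### Matchings as matchable sets of queues. -/

section Service

variable {N K : ℕ}

/-- The number of services that `M` offers to each queue through connected servers. -/
def service (c : Fin N → Fin K → Bool) (M : Matching N K) : Fin N → ℕ :=
  fun n => ∑ k, (c n k).toNat * M.toMat n k

/-- The queues that `M` assigns to a connected server. -/
def servedSet (c : Fin N → Fin K → Bool) (M : Matching N K) : Finset (Fin N) :=
  Finset.univ.filter fun n => ∃ k, c n k = true ∧ M.toMat n k = 1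

theorem service_le_one (c : Fin N → Fin K → Bool) (M : Matching N K) (n : Fin N) :
    service c M n ≤ 1 := by
  refine le_trans (Finset.sum_le_sum fun k _ => ?_) (M.row_sum_le n)
  cases c n k <;> simp

theorem service_eq (c : Fin N → Fin K → Bool) (M : Matching N K) (n : Fin N) :
    service c M n = if n ∈ servedSet c M then 1 else 0 := by
  split_ifs with h
  · obtain ⟨k, hk, hM⟩ := (Finset.mem_filter.1 h).2
    refine le_antisymm (service_le_one c M n) ?_
    have := Finset.single_le_sum (f := fun k => (c n k).toNat * M.toMat n k)
      (fun _ _ => Nat.zero_le _) (Finset.mem_univ k)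
    simpa [service, hk, hM] using this
  · refine Finset.sum_eq_zero fun k _ => ?_
    rcases M.zero_or_one n k with h0 | h1
    · simp [h0]
    · have : c n k = false := by
        by_contra hc
        exact h (Finset.mem_filter.2 ⟨Finset.mem_univ n, k, by simpa using hc, h1⟩)
      simp [this]

theorem sub_service (x : Fin N → ℕ) (c : Fin N → Fin K → Bool) (M : Matching N K) :
    (fun n => x n - service c M n) = serve x (servedSet c M) := by
  funext n
  rw [service_eq]
  rfl

theorem matchingWeight_eq (x : Fin N → ℕ) (c : Fin N → Fin K → Bool) (M : Matching N K) :
    matchingWeight x c M = ∑ n ∈ servedSet c M, x n := by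
  have h : ∀ n, x n * ∑ k, M.toMat n k * (c n k).toNat
      = if n ∈ servedSet c M then x n else 0 := by
    intro n
    have : ∑ k, M.toMat n k * (c n k).toNat = service c M n :=
      Finset.sum_congr rfl fun k _ => mul_comm _ _
    rw [this, service_eq]
    split_ifs <;> simp
  unfold matchingWeight
  rw [Finset.sum_congr rfl fun n _ => h n, Finset.sum_ite_mem, Finset.univ_inter]

/-- The connectivity relation; the additional value `none` is connected to no queue. -/
def Connected (c : Fin N → Fin K → Bool) (n : Fin N) (o : Option (Fin K)) : Prop :=
  ∃ k, o = some k ∧ c n k = true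

theorem matchable_servedSet (c : Fin N → Fin K → Bool) (M : Matching N K) :
    Matchable (Connected c) (servedSet c M) := by
  classical
  -- `none` is a default partner for unserved queues, available even when `K = 0`.
  have h : ∀ n, ∃ o : Option (Fin K), n ∈ servedSet c M →
      ∃ k, o = some k ∧ c n k = true ∧ M.toMat n k = 1 := by
    intro n
    by_cases hn : n ∈ servedSet c M
    · obtain ⟨k, hk⟩ := (Finset.mem_filter.1 hn).2
      exact ⟨some k, fun _ => ⟨k, rfl, hk⟩⟩
    · exact ⟨none, fun h => absurd h hn⟩
  choose f hf using h
  refine ⟨f, ?_, fun n hn => ?_⟩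
  · intro n hn m hm he
    obtain ⟨k, hk, -, hM⟩ := hf n hn
    obtain ⟨l, hl, -, hM'⟩ := hf m hm
    have hkl : k = l := by
      rw [hk, hl] at he
      exact Option.some.inj he
    subst hkl
    by_contra hnm
    have h1 := M.col_sum_le k
    have h2 := Finset.sum_le_sum_of_subset (f := fun i => M.toMat i k)
      (Finset.subset_univ {n, m})
    rw [Finset.sum_pair hnm, hM, hM'] at h2
    omega
  · obtain ⟨k, hk, hc, -⟩ := hf n hn
    exact ⟨k, hk, hc⟩

/-- With this converse of `matchable_servedSet`, a maximum over matchings is a maximum over all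
matchable sets, as the exchange argument requires. -/
theorem exists_servedSet_eq {c : Fin N → Fin K → Bool} {J : Finset (Fin N)}
    (hJ : Matchable (Connected c) J) : ∃ M : Matching N K, servedSet c M = J := by
  classical
  obtain ⟨f, hf, hc⟩ := hJ
  refine ⟨⟨fun n k => if n ∈ J ∧ f n = some k then 1 else 0, fun n k => ?_, fun n => ?_,
    fun k => ?_⟩, ?_⟩
  · split_ifs <;> simp
  · rw [Finset.sum_boole, Nat.cast_id, Finset.card_le_one]
    intro k hk l hl
    simp only [Finset.mem_filter, Finset.mem_univ, true_and] at hk hl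
    exact Option.some.inj (hk.2.symm.trans hl.2)
  · rw [Finset.sum_boole, Nat.cast_id, Finset.card_le_one]
    intro n hn m hm
    simp only [Finset.mem_filter, Finset.mem_univ, true_and] at hn hm
    exact hf hn.1 hm.1 (hn.2.trans hm.2.symm)
  · ext n
    simp only [servedSet, Finset.mem_filter, Finset.mem_univ, true_and]
    constructor
    · rintro ⟨k, -, hk⟩
      by_contra hn
      simp [hn] at hk
    · intro hn
      obtain ⟨k, hk, hck⟩ := hc n hn
      exact ⟨k, hck, by simp [hn, hk]⟩

/-- Serving a maximum weighted matching is best possible with respect to `⪯ₚ`. -/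
theorem IsMaxWeightMatching.balOrder {x : Fin N → ℕ} {c : Fin N → Fin K → Bool}
    {M : Matching N K} (hM : IsMaxWeightMatching x c M) (M' : Matching N K) :
    BalOrder (fun n => x n - service c M n) (fun n => x n - service c M' n) := by
  rw [sub_service, sub_service]
  refine balOrder_serve fun v hv => (matchable_servedSet c M).card_filter_le_of_isMax ?_
    (matchable_servedSet c M') hv
  intro J hJ
  obtain ⟨L, rfl⟩ := exists_servedSet_eq hJ
  rw [← matchingWeight_eq, ← matchingWeight_eq]
  exact hM L

theorem exists_isMaxWeightMatching (x : Fin N → ℕ) (c : Fin N → Fin K → Bool) :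
    ∃ M : Matching N K, IsMaxWeightMatching x c M := by
  have hbdd : ∀ M : Matching N K, matchingWeight x c M ≤ ∑ n, x n := fun M => by
    rw [matchingWeight_eq]
    exact Finset.sum_le_sum_of_subset (Finset.subset_univ _)
  let M₀ : Matching N K := ⟨fun _ _ => 0, fun _ _ => Or.inl rfl, by simp, by simp⟩
  have hne : (Set.range fun M : Matching N K => matchingWeight x c M).Nonempty := ⟨_, M₀, rfl⟩
  have habove : BddAbove (Set.range fun M : Matching N K => matchingWeight x c M) :=
    ⟨∑ n, x n, by rintro _ ⟨M, rfl⟩; exact hbdd M⟩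
  obtain ⟨M, hM⟩ := Nat.sSup_mem hne habove
  exact ⟨M, fun M' => (le_csSup habove ⟨M', rfl⟩).trans hM.ge⟩

/-- A maximum weighted matching. -/
noncomputable def mwm (x : Fin N → ℕ) (c : Fin N → Fin K → Bool) : Matching N K :=
  (exists_isMaxWeightMatching x c).choose

theorem isMaxWeightMatching_mwm (x : Fin N → ℕ) (c : Fin N → Fin K → Bool) :
    IsMaxWeightMatching x c (mwm x c) :=
  (exists_isMaxWeightMatching x c).choose_spec

/-- The matching that treats the queues as relabelled by `σ`. -/
def Matching.permute (M : Matching N K) (σ : Equiv.Perm (Fin N)) : Matching N K where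
  toMat n k := M.toMat (σ n) k
  zero_or_one n k := M.zero_or_one (σ n) k
  row_sum_le n := M.row_sum_le (σ n)
  col_sum_le k := by
    rw [Equiv.sum_comp σ fun n => M.toMat n k]
    exact M.col_sum_le k

end Service

/-! ### The one-slot operators preserve monotone costs. -/

section Monotone

open scoped ENNReal

variable {N K : ℕ}

/-- Cost functions with values in `[0, ∞]`. -/
def BalMono (V : (Fin N → ℕ) → ℝ≥0∞) : Prop :=
  ∀ y x, BalLE y x → V y ≤ V x

theorem BalMono.le {V : (Fin N → ℕ) → ℝ≥0∞} (hV : BalMono V) {y x : Fin N → ℕ}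
    (h : BalOrder y x) : V y ≤ V x := by
  induction h with
  | single h => exact hV _ _ h
  | tail _ h ih => exact ih.trans (hV _ _ h)

theorem balLE_comp_swap (x : Fin N → ℕ) {n m : Fin N} (h : n ≠ m) :
    BalLE (x ∘ Equiv.swap n m) x :=
  Or.inr (Or.inl ⟨n, m, h, by simp, by simp, fun i hi hi' => by
    simp [Equiv.swap_apply_of_ne_of_ne hi hi']⟩)

theorem eq_comp_swap {y x : Fin N → ℕ} {n m : Fin N} (h1 : y n = x m) (h2 : y m = x n)
    (h3 : ∀ i, i ≠ n → i ≠ m → y i = x i) : y = x ∘ Equiv.swap n m := by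
  funext i
  by_cases hn : i = n
  · simp [hn, h1]
  by_cases hm : i = m
  · simp [hm, h2]
  simp [Equiv.swap_apply_of_ne_of_ne hn hm, h3 i hn hm]

/-- The probability weights of a Bernoulli variable. -/
noncomputable def bernoulliWeight (q : ℝ) (b : Bool) : ℝ≥0∞ :=
  if b then ENNReal.ofReal q else ENNReal.ofReal (1 - q)

/-- The expected cost after one batch of arrivals. -/
noncomputable def arrivalMean (lam : ℝ) (V : (Fin N → ℕ) → ℝ≥0∞) (x : Fin N → ℕ) : ℝ≥0∞ :=
  ∑ a : Fin N → Bool, (∏ n, bernoulliWeight lam (a n)) * V fun n => x n + (a n).toNat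

/-- The expected cost after one service by a maximum weighted matching. -/
noncomputable def serviceMean (K : ℕ) (p : ℝ) (V : (Fin N → ℕ) → ℝ≥0∞) (x : Fin N → ℕ) : ℝ≥0∞ :=
  ∑ c : Fin N → Fin K → Bool, (∏ n, ∏ k, bernoulliWeight p (c n k)) *
    V fun n => x n - service c (mwm x c) n

/-- Componentwise order and balancing are handled for each arrival vector separately. Exchanged
entries are comparable only on average: the arrivals are relabelled by the same transposition, which
keeps their weight. -/
theorem BalMono.arrivalMean {V : (Fin N → ℕ) → ℝ≥0∞} (hV : BalMono V) (lam : ℝ) :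
    BalMono (arrivalMean lam V) := by
  rintro y x (h | ⟨n, m, hnm, h1, h2, h3⟩ | ⟨n, m, hnm, h1, h2, h3, h4, h5, h6⟩)
  · exact Finset.sum_le_sum fun a _ => mul_le_mul_right
      (hV _ _ (Or.inl fun n => Nat.add_le_add_right (h n) _)) _
  · rw [eq_comp_swap h1 h2 h3]
    unfold _root_.arrivalMean
    rw [← Equiv.sum_comp ((Equiv.swap n m).arrowCongr (Equiv.refl Bool))]
    refine Finset.sum_le_sum fun a _ => ?_
    have e : (∏ i, bernoulliWeight lam
        (((Equiv.swap n m).arrowCongr (Equiv.refl Bool)) a i)) = ∏ i, bernoulliWeight lam (a i) :=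
      Equiv.prod_comp (Equiv.swap n m) fun i => bernoulliWeight lam (a i)
    rw [e]
    exact mul_le_mul_right (hV _ _ (balLE_comp_swap (fun i => x i + (a i).toNat) hnm)) _
  · refine Finset.sum_le_sum fun a _ => mul_le_mul_right (hV _ _ ?_) _
    have han := Bool.toNat_le (a n)
    have ham := Bool.toNat_le (a m)
    by_cases hc : y n + (a n).toNat ≤ y m + (a m).toNat
    · refine Or.inr (Or.inr ⟨n, m, hnm, ?_, hc, ?_, ?_, ?_, fun i hi hi' => ?_⟩)
      · simp only
        omega
      · simp only
        omega
      · simp only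
        omega
      · simp only
        omega
      · simp only [h6 i hi hi']
    -- Here `y n = y m` and only queue `n` gets a packet, so the two vectors become exchanges of
    -- each other.
    · refine Or.inr (Or.inl ⟨n, m, hnm, ?_, ?_, fun i hi hi' => ?_⟩)
      · simp only
        omega
      · simp only
        omega
      · simp only [h6 i hi hi']

theorem balLE_sub {y x d : Fin N → ℕ} (hd : ∀ n, d n ≤ 1) {n m : Fin N} (hnm : n ≠ m)
    (h2 : y n ≤ y m) (h4 : y n = x n + 1) (h5 : x m = y m + 1)
    (h6 : ∀ i, i ≠ n → i ≠ m → y i = x i) :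
    BalLE (fun i => y i - d i) (fun i => x i - d i) := by
  have hdn := hd n
  have hdm := hd m
  -- Truncation makes both `n`-th entries zero here, which leaves a componentwise comparison.
  by_cases hc : d n = 1 ∧ x n = 0
  · refine Or.inl fun i => ?_
    by_cases hin : i = n
    · subst hin
      simp only
      omega
    by_cases him : i = m
    · subst him
      simp only
      omega
    simp only [h6 i hin him, le_refl]
  by_cases hc' : y n - d n ≤ y m - d m
  · refine Or.inr (Or.inr ⟨n, m, hnm, ?_, hc', ?_, ?_, ?_, fun i hi hi' => ?_⟩)
    · simp only
      omega
    · simp only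
      omega
    · simp only
      omega
    · simp only
      omega
    · simp only [h6 i hi hi']
  · refine Or.inr (Or.inl ⟨n, m, hnm, ?_, ?_, fun i hi hi' => ?_⟩)
    · simp only
      omega
    · simp only
      omega
    · simp only [h6 i hi hi']

theorem BalMono.mwm_le {V : (Fin N → ℕ) → ℝ≥0∞} (hV : BalMono V) (x : Fin N → ℕ)
    (c : Fin N → Fin K → Bool) (M : Matching N K) :
    V (fun n => x n - service c (mwm x c) n) ≤ V fun n => x n - service c M n :=
  hV.le ((isMaxWeightMatching_mwm x c).balOrder M)

/-- From the lower state `y` it suffices to imitate the matching chosen at `x`, since MWM does at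
least as well as any imitation. -/
theorem BalMono.serviceMean {V : (Fin N → ℕ) → ℝ≥0∞} (hV : BalMono V) (p : ℝ) :
    BalMono (serviceMean K p V) := by
  rintro y x (h | ⟨n, m, hnm, h1, h2, h3⟩ | ⟨n, m, hnm, h1, h2, h3, h4, h5, h6⟩)
  · exact Finset.sum_le_sum fun c _ => mul_le_mul_right ((hV.mwm_le y c (mwm x c)).trans
      (hV _ _ (Or.inl fun n => Nat.sub_le_sub_right (h n) _))) _
  · rw [eq_comp_swap h1 h2 h3]
    unfold _root_.serviceMean
    rw [← Equiv.sum_comp ((Equiv.swap n m).arrowCongr (Equiv.refl (Fin K → Bool)))]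
    refine Finset.sum_le_sum fun c _ => ?_
    have e : (∏ i, ∏ k, bernoulliWeight p
        (((Equiv.swap n m).arrowCongr (Equiv.refl (Fin K → Bool))) c i k))
          = ∏ i, ∏ k, bernoulliWeight p (c i k) :=
      Equiv.prod_comp (Equiv.swap n m) fun i => ∏ k, bernoulliWeight p (c i k)
    rw [e]
    -- The choice `mwm` need not commute with relabelling; the permuted matching enters only as a
    -- competitor.
    refine mul_le_mul_right ((hV.mwm_le _ _ ((mwm x c).permute (Equiv.swap n m))).trans ?_) _
    exact hV _ _ (balLE_comp_swap (fun i => x i - service c (mwm x c) i) hnm)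
  · exact Finset.sum_le_sum fun c _ => mul_le_mul_right ((hV.mwm_le y c (mwm x c)).trans
      (hV _ _ (balLE_sub (service_le_one c _) hnm h2 h4 h5 h6))) _

end Monotone

/-! ### Averaging over one slot by independence. -/

section Sampling

open scoped ENNReal

variable {Ω S : Type*} [MeasurableSpace Ω] [MeasurableSpace S] {N K : ℕ} {P : Measure Ω}
  [IsProbabilityMeasure P] {p lam : ℝ} {X₀ : Ω → Fin N → ℕ}
  {C : ℕ → Fin N → Fin K → Ω → Bool} {A : ℕ → Fin N → Ω → Bool} {U : Ω → S}

theorem measure_eq_bernoulliWeight {B : Ω → Bool} (hB : Measurable B) {q : ℝ}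
    (hq : P.real {ω | B ω = true} = q) (b : Bool) :
    P (B ⁻¹' {b}) = bernoulliWeight q b := by
  have htrue : P (B ⁻¹' {true}) = ENNReal.ofReal q := by
    rw [← hq, ofReal_measureReal]
    rfl
  cases b with
  | true => simpa [bernoulliWeight] using htrue
  | false =>
    have hc : B ⁻¹' {false} = (B ⁻¹' {true})ᶜ := by
      ext ω
      simp
    have hq0 : 0 ≤ q := hq ▸ measureReal_nonneg
    rw [hc, prob_compl_eq_one_sub (hB (measurableSet_singleton true)), htrue, bernoulliWeight,
      if_neg (by simp), ENNReal.ofReal_sub 1 hq0, ENNReal.ofReal_one]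

namespace IsQueueingModel

theorem measure_slot (h : IsQueueingModel P p lam X₀ C A U) (t : ℕ)
    (c : Fin N → Fin K → Bool) (a : Fin N → Bool) :
    P ((fun ω => ((fun n k => C t n k ω, fun n => A t n ω) :
        (Fin N → Fin K → Bool) × (Fin N → Bool))) ⁻¹' {(c, a)})
      = (∏ n, ∏ k, bernoulliWeight p (c n k)) * ∏ n, bernoulliWeight lam (a n) := by
  have hinj : Function.Injective (Sum.map (fun j : Fin N × Fin K => (t, j.1, j.2))
      (fun n : Fin N => (t, n))) := by
    refine Function.Injective.sumMap ?_ ?_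
    · rintro ⟨n, k⟩ ⟨m, l⟩ he
      simpa using he
    · intro n m he
      simpa using he
  have hind := h.indep_C_A.precomp hinj
  have hmeas := hind.meas_iInter (s := fun j => Sum.elim
    (fun j : Fin N × Fin K => C t j.1 j.2 ⁻¹' {c j.1 j.2}) (fun n => A t n ⁻¹' {a n}) j) (by
      rintro (j | n)
      · exact ⟨{c j.1 j.2}, measurableSet_singleton _, rfl⟩
      · exact ⟨{a n}, measurableSet_singleton _, rfl⟩)
  have hset : (fun ω => ((fun n k => C t n k ω, fun n => A t n ω) :
        (Fin N → Fin K → Bool) × (Fin N → Bool))) ⁻¹' {(c, a)} = ⋂ j, Sum.elim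
    (fun j : Fin N × Fin K => C t j.1 j.2 ⁻¹' {c j.1 j.2}) (fun n => A t n ⁻¹' {a n}) j := by
    ext ω
    simp [Set.mem_iInter, funext_iff]
  rw [hset, hmeas, Fintype.prod_sum_type, Fintype.prod_prod_type]
  simp only [Sum.elim_inl, Sum.elim_inr]
  simp only [measure_eq_bernoulliWeight (h.measurable_C t _ _) (h.prob_C t _ _),
    measure_eq_bernoulliWeight (h.measurable_A t _) (h.prob_A t _)]

theorem lintegral_slot (h : IsQueueingModel P p lam X₀ C A U) (t : ℕ)
    (H : (Fin N → Fin K → Bool) → (Fin N → Bool) → ℝ≥0∞) :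
    ∫⁻ ω, H (fun n k => C t n k ω) (fun n => A t n ω) ∂P
      = ∑ c : Fin N → Fin K → Bool, (∏ n, ∏ k, bernoulliWeight p (c n k)) *
          ∑ a : Fin N → Bool, (∏ n, bernoulliWeight lam (a n)) * H c a := by
  have hZ : Measurable (fun ω => ((fun n k => C t n k ω, fun n => A t n ω) :
        (Fin N → Fin K → Bool) × (Fin N → Bool))) :=
    (measurable_pi_lambda _ fun n => measurable_pi_lambda _ fun k => h.measurable_C t n k).prodMk
      (measurable_pi_lambda _ fun n => h.measurable_A t n)
  have hH : Measurable (Function.uncurry H) := measurable_of_countable _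
  have := lintegral_map (μ := P) hH hZ
  simp only [Function.uncurry] at this
  rw [← this, lintegral_fintype, Fintype.sum_prod_type]
  refine Finset.sum_congr rfl fun c _ => ?_
  rw [Finset.mul_sum]
  refine Finset.sum_congr rfl fun a _ => ?_
  rw [Measure.map_apply hZ (measurableSet_singleton _), h.measure_slot]
  ring

/-- The variables of slot `t` can be averaged out separately from those of the earlier slots. -/
theorem lintegral_history (h : IsQueueingModel P p lam X₀ C A U) (t : ℕ)
    (G : (ℕ → Fin N → Fin K → Bool) → (ℕ → Fin N → Bool) →
      (Fin N → Fin K → Bool) → (Fin N → Bool) → ℝ≥0∞)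
    (hG : ∀ c c' a a', (∀ i < t, c i = c' i) → (∀ i < t, a i = a' i) → G c a = G c' a') :
    ∫⁻ ω, G (fun i n k => C i n k ω) (fun i n => A i n ω)
        (fun n k => C t n k ω) (fun n => A t n ω) ∂P
      = ∫⁻ ω, ∑ c : Fin N → Fin K → Bool, (∏ n, ∏ k, bernoulliWeight p (c n k)) *
          ∑ a : Fin N → Bool, (∏ n, bernoulliWeight lam (a n)) *
            G (fun i n k => C i n k ω) (fun i n => A i n ω) c a ∂P := by
  classical
  let f : (ℕ × Fin N × Fin K) ⊕ (ℕ × Fin N) → Ω → Bool := fun i =>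
    Sum.elim (fun j => C j.1 j.2.1 j.2.2) (fun j => A j.1 j.2) i
  have hf : ∀ i, Measurable (f i) := by
    rintro (j | j)
    · exact h.measurable_C _ _ _
    · exact h.measurable_A _ _
  -- Finite blocks of coordinates make all measurability automatic. Paths are rebuilt with `false`
  -- outside the block, which is harmless by `hG`.
  let slots : Finset ℕ → Finset ((ℕ × Fin N × Fin K) ⊕ (ℕ × Fin N)) := fun T =>
    (T ×ˢ Finset.univ).disjSum (T ×ˢ Finset.univ)
  have hinl : ∀ T i n k, Sum.inl (i, n, k) ∈ slots T ↔ i ∈ T := by simp [slots]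
  have hinr : ∀ T i n, Sum.inr (i, n) ∈ slots T ↔ i ∈ T := by simp [slots]
  let links : ∀ T, (slots T → Bool) → ℕ → Fin N → Fin K → Bool := fun T r i n k =>
    if hi : i ∈ T then r ⟨_, (hinl T i n k).2 hi⟩ else false
  let arr : ∀ T, (slots T → Bool) → ℕ → Fin N → Bool := fun T r i n =>
    if hi : i ∈ T then r ⟨_, (hinr T i n).2 hi⟩ else false
  let ξ : ∀ T : Finset ℕ, Ω → slots T → Bool := fun T ω i => f i ω
  have hξ : ∀ T, Measurable (ξ T) := fun T => measurable_pi_lambda _ fun i => hf i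
  have hlinks : ∀ T, ∀ i ∈ T, ∀ ω, links T (ξ T ω) i = fun n k => C i n k ω := by
    intro T i hi ω
    funext n k
    simp only [links, dif_pos hi]
    rfl
  have harr : ∀ T, ∀ i ∈ T, ∀ ω, arr T (ξ T ω) i = fun n => A i n ω := by
    intro T i hi ω
    funext n
    simp only [arr, dif_pos hi]
    rfl
  have hdisj : Disjoint (slots (Finset.range t)) (slots {t}) := by
    rw [Finset.disjoint_left]
    rintro (⟨i, n, k⟩ | ⟨i, n⟩) h1 h2
    · rw [hinl] at h1 h2
      simp only [Finset.mem_range, Finset.mem_singleton] at h1 h2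
      omega
    · rw [hinr] at h1 h2
      simp only [Finset.mem_range, Finset.mem_singleton] at h1 h2
      omega
  have hind : IndepFun (ξ (Finset.range t)) (ξ {t}) P :=
    h.indep_C_A.indepFun_finset _ _ hdisj hf
  let F : (slots (Finset.range t) → Bool) × (slots {t} → Bool) → ℝ≥0∞ := fun r =>
    G (links _ r.1) (arr _ r.1) (links _ r.2 t) (arr _ r.2 t)
  have hF : Measurable F := measurable_of_countable _
  have hFG : ∀ ω ω', F (ξ _ ω, ξ _ ω') = G (fun i n k => C i n k ω) (fun i n => A i n ω)
      (fun n k => C t n k ω') (fun n => A t n ω') := by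
    intro ω ω'
    simp only [F]
    rw [hlinks {t} t (Finset.mem_singleton_self t), harr {t} t (Finset.mem_singleton_self t)]
    rw [hG _ (fun i n k => C i n k ω) _ (fun i n => A i n ω)
      (fun i hi => hlinks _ i (Finset.mem_range.2 hi) ω)
      (fun i hi => harr _ i (Finset.mem_range.2 hi) ω)]
  calc ∫⁻ ω, G (fun i n k => C i n k ω) (fun i n => A i n ω)
        (fun n k => C t n k ω) (fun n => A t n ω) ∂P
      = ∫⁻ ω, F (ξ _ ω, ξ _ ω) ∂P := lintegral_congr fun ω => (hFG ω ω).symm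
    _ = ∫⁻ r, F r ∂(P.map fun ω => (ξ (Finset.range t) ω, ξ {t} ω)) :=
        (lintegral_map hF ((hξ _).prodMk (hξ _))).symm
    _ = ∫⁻ ω, ∫⁻ ω', F (ξ _ ω, ξ _ ω') ∂P ∂P := by
        rw [hind.map_prod_eq_prod_map_map (hξ _).aemeasurable (hξ _).aemeasurable,
          lintegral_prod _ hF.aemeasurable,
          lintegral_map hF.lintegral_prod_right' (hξ _)]
        exact lintegral_congr fun ω =>
          lintegral_map (hF.comp measurable_prodMk_left) (hξ _)
    _ = _ := by
        refine lintegral_congr fun ω => ?_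
        simp only [hFG]
        exact h.lintegral_slot t _

end IsQueueingModel

end Sampling

/-! ### Measurability of queues, and the max-weight policy. -/

namespace Policy

variable {N K : ℕ} {S : Type*} [MeasurableSpace S]

theorem queue_congr (π : Policy N K S) (s : S) (x₀ : Fin N → ℕ)
    {c c' : ℕ → Fin N → Fin K → Bool} {a a' : ℕ → Fin N → Bool} {t : ℕ}
    (hc : ∀ i < t, c i = c' i) (ha : ∀ i < t, a i = a' i) :
    π.queue s x₀ c a t = π.queue s x₀ c' a' t := by
  induction t with
  | zero => rfl
  | succ t ih =>
    unfold queue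
    rw [ih (fun i hi => hc i (by omega)) fun i hi => ha i (by omega), hc t (by omega),
      ha t (by omega), π.causal t s x₀ c c' a a' (fun i hi => hc i (by omega))
        fun i hi => ha i (by omega)]

theorem queue_succ (π : Policy N K S) (s : S) (x₀ : Fin N → ℕ) (c : ℕ → Fin N → Fin K → Bool)
    (a : ℕ → Fin N → Bool) (t : ℕ) :
    π.queue s x₀ c a (t + 1) = fun n =>
      (π.queue s x₀ c a t n - service (c t) (π.matching t s x₀ c a) n) + (a t n).toNat :=
  rfl

theorem measurable_queue_seed (π : Policy N K S) (x₀ : Fin N → ℕ)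
    (c : ℕ → Fin N → Fin K → Bool) (a : ℕ → Fin N → Bool) (t : ℕ) :
    Measurable fun s => π.queue s x₀ c a t := by
  have : Finite (Matching N K) := by
    refine Finite.of_injective
      (fun (M : Matching N K) n k => (⟨M.toMat n k, by
        rcases M.zero_or_one n k with h | h <;> omega⟩ : Fin 2)) ?_
    intro M M' he
    have : M.toMat = M'.toMat := by
      funext n k
      simpa using congrFun (congrFun he n) k
    cases M
    cases M'
    simpa using this
  induction t with
  | zero => exact measurable_const
  | succ t ih =>
    let _ : MeasurableSpace (Matching N K) := ⊤
    have hM : Measurable fun s => π.matching t s x₀ c a :=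
      measurable_to_countable' fun M => π.measurable_seed t x₀ c a M
    refine measurable_pi_lambda _ fun n => ?_
    simp only [queue_succ]
    exact (((measurable_pi_apply n).comp ih).sub
      ((measurable_from_top (f := fun M => service (c t) M n)).comp hM)).add_const _

/-- By causality the queue sees finitely many slots, so it factors through `S` times a countable
space, where measurability in the seed suffices. -/
theorem measurable_queue (π : Policy N K S) (t : ℕ) :
    Measurable fun z : ((Fin N → ℕ) × S) × ((ℕ → Fin N → Fin K → Bool) × (ℕ → Fin N → Bool)) =>
      π.queue z.1.2 z.1.1 z.2.1 z.2.2 t := by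
  let F : S × ((Fin N → ℕ) × (Fin t → Fin N → Fin K → Bool) × (Fin t → Fin N → Bool)) →
      Fin N → ℕ := fun w => π.queue w.1 w.2.1
    (fun i n k => if hi : i < t then w.2.2.1 ⟨i, hi⟩ n k else false)
    (fun i n => if hi : i < t then w.2.2.2 ⟨i, hi⟩ n else false) t
  have hF : Measurable F := measurable_from_prod_countable_left fun w =>
    π.measurable_queue_seed w.1 (fun i n k => if hi : i < t then w.2.1 ⟨i, hi⟩ n k else false)
      (fun i n => if hi : i < t then w.2.2 ⟨i, hi⟩ n else false) t
  have hr : Measurable fun z : ((Fin N → ℕ) × S) ×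
      ((ℕ → Fin N → Fin K → Bool) × (ℕ → Fin N → Bool)) =>
      ((z.1.2, z.1.1, fun i : Fin t => z.2.1 i, fun i : Fin t => z.2.2 i) :
        S × (Fin N → ℕ) × (Fin t → Fin N → Fin K → Bool) × (Fin t → Fin N → Bool)) := by
    fun_prop
  have : (fun z : ((Fin N → ℕ) × S) × ((ℕ → Fin N → Fin K → Bool) × (ℕ → Fin N → Bool)) =>
      π.queue z.1.2 z.1.1 z.2.1 z.2.2 t) = F ∘ fun z =>
      (z.1.2, z.1.1, fun i : Fin t => z.2.1 i, fun i : Fin t => z.2.2 i) := by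
    funext z
    refine π.queue_congr _ _ (fun i hi => ?_) fun i hi => ?_
    · funext n k
      simp [hi]
    · funext n
      simp [hi]
  rw [this]
  exact hF.comp hr

/-- The queue lengths when maximum weighted matchings are employed throughout. -/
noncomputable def mwmQueue (x₀ : Fin N → ℕ) (c : ℕ → Fin N → Fin K → Bool)
    (a : ℕ → Fin N → Bool) : ℕ → Fin N → ℕ
  | 0 => x₀
  | t + 1 => fun n => (mwmQueue x₀ c a t n - service (c t) (mwm (mwmQueue x₀ c a t) (c t)) n)
      + (a t n).toNat

theorem mwmQueue_congr (x₀ : Fin N → ℕ) {c c' : ℕ → Fin N → Fin K → Bool}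
    {a a' : ℕ → Fin N → Bool} {t : ℕ} (hc : ∀ i < t, c i = c' i) (ha : ∀ i < t, a i = a' i) :
    mwmQueue x₀ c a t = mwmQueue x₀ c' a' t := by
  induction t with
  | zero => rfl
  | succ t ih =>
    unfold mwmQueue
    rw [ih (fun i hi => hc i (by omega)) fun i hi => ha i (by omega), hc t (by omega),
      ha t (by omega)]

variable (N K S) in
/-- A policy that employs a maximum weighted matching in every slot. -/
noncomputable def maxWeight : Policy N K S where
  matching t _ x₀ c a := mwm (mwmQueue x₀ c a t) (c t)
  causal t s x₀ c c' a a' hc ha := by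
    rw [mwmQueue_congr x₀ (fun i hi => hc i hi.le) ha, hc t le_rfl]
  measurable_seed _ _ _ _ _ := MeasurableSet.const _

theorem queue_maxWeight (s : S) (x₀ : Fin N → ℕ) (c : ℕ → Fin N → Fin K → Bool)
    (a : ℕ → Fin N → Bool) (t : ℕ) :
    (maxWeight N K S).queue s x₀ c a t = mwmQueue x₀ c a t := by
  induction t with
  | zero => rfl
  | succ t ih =>
    rw [queue_succ, ih]
    rfl

theorem matching_maxWeight (s : S) (x₀ : Fin N → ℕ) (c : ℕ → Fin N → Fin K → Bool)
    (a : ℕ → Fin N → Bool) (t : ℕ) :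
    (maxWeight N K S).matching t s x₀ c a
      = mwm ((maxWeight N K S).queue s x₀ c a t) (c t) := by
  rw [queue_maxWeight]
  rfl

theorem isMWM_maxWeight : (maxWeight N K S).IsMWM := fun s x₀ c a t => by
  rw [matching_maxWeight]
  exact isMaxWeightMatching_mwm _ _

end Policy

/-! ### Comparison by induction on the horizon. -/

section Comparison

open scoped ENNReal

variable {Ω S : Type*} [MeasurableSpace Ω] [MeasurableSpace S] {N K : ℕ} {P : Measure Ω}
  [IsProbabilityMeasure P] {p lam : ℝ} {X₀ : Ω → Fin N → ℕ}
  {C : ℕ → Fin N → Fin K → Ω → Bool} {A : ℕ → Fin N → Ω → Bool} {U : Ω → S}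

namespace IsQueueingModel

/-- The slot-`t` matching sees the connectivities of slot `t` but not its arrivals, so arrivals are
averaged after service. `Function.update` inserts the fresh connectivities into the history. -/
theorem lintegral_queue_succ (h : IsQueueingModel P p lam X₀ C A U) (π : Policy N K S) (s : S)
    (x₀ : Fin N → ℕ) (t : ℕ) (V : (Fin N → ℕ) → ℝ≥0∞) :
    ∫⁻ ω, V (π.queue s x₀ (fun i n k => C i n k ω) (fun i n => A i n ω) (t + 1)) ∂P
      = ∫⁻ ω, ∑ c : Fin N → Fin K → Bool, (∏ n, ∏ k, bernoulliWeight p (c n k)) *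
          arrivalMean lam V (fun n =>
            π.queue s x₀ (fun i n k => C i n k ω) (fun i n => A i n ω) t n -
              service c (π.matching t s x₀ (Function.update (fun i n k => C i n k ω) t c)
                (fun i n => A i n ω)) n) ∂P := by
  have := h.lintegral_history t (fun c' a' c a => V fun n =>
    (π.queue s x₀ c' a' t n - service c (π.matching t s x₀ (Function.update c' t c) a') n)
      + (a n).toNat) (by
    intro c c' a a' hc ha
    funext d b
    have hm : π.matching t s x₀ (Function.update c t d) a
        = π.matching t s x₀ (Function.update c' t d) a' := by
      refine π.causal t s x₀ _ _ _ _ (fun i hi => ?_) ha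
      rcases hi.eq_or_lt with rfl | hi
      · simp
      · rw [Function.update_of_ne hi.ne, Function.update_of_ne hi.ne, hc i hi]
    rw [π.queue_congr s x₀ hc ha, hm])
  refine Eq.trans ?_ this
  refine lintegral_congr fun ω => ?_
  rw [Policy.queue_succ]
  dsimp only
  rw [show Function.update (fun i n k => C i n k ω) t (fun n k => C t n k ω)
    = fun i n k => C i n k ω from Function.update_eq_self t _]

theorem lintegral_maxWeight_le (h : IsQueueingModel P p lam X₀ C A U) (π : Policy N K S) (s : S)
    (x₀ : Fin N → ℕ) (t : ℕ) {V : (Fin N → ℕ) → ℝ≥0∞} (hV : BalMono V) :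
    ∫⁻ ω, V ((Policy.maxWeight N K S).queue s x₀
        (fun i n k => C i n k ω) (fun i n => A i n ω) t) ∂P
      ≤ ∫⁻ ω, V (π.queue s x₀ (fun i n k => C i n k ω) (fun i n => A i n ω) t) ∂P := by
  induction t generalizing V with
  | zero => exact le_rfl
  | succ t ih =>
    rw [h.lintegral_queue_succ, h.lintegral_queue_succ]
    -- The slot operator is exact for MWM and a lower bound for `π`; the induction hypothesis is
    -- used for the transformed cost.
    refine le_trans (le_of_eq ?_) ((ih ((hV.arrivalMean lam).serviceMean (K := K) p)).trans
      (lintegral_mono fun ω => ?_))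
    · refine lintegral_congr fun ω => ?_
      unfold serviceMean
      refine Finset.sum_congr rfl fun c _ => ?_
      rw [Policy.matching_maxWeight, Function.update_self,
        (Policy.maxWeight N K S).queue_congr s x₀
          (c := Function.update (fun i n k => C i n k ω) t c) (c' := fun i n k => C i n k ω)
          (fun i hi => Function.update_of_ne hi.ne _ _) fun _ _ => rfl]
    · exact Finset.sum_le_sum fun c _ =>
        mul_le_mul_right ((hV.arrivalMean lam).mwm_le _ c _) _

omit [IsProbabilityMeasure P] in
theorem measurable_paths (h : IsQueueingModel P p lam X₀ C A U) :
    Measurable (fun ω => (fun t n k => C t n k ω, fun t n => A t n ω) :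
      Ω → (ℕ → Fin N → Fin K → Bool) × (ℕ → Fin N → Bool)) :=
  (measurable_pi_lambda _ fun i => measurable_pi_lambda _ fun n =>
    measurable_pi_lambda _ fun k => h.measurable_C i n k).prodMk
    (measurable_pi_lambda _ fun i => measurable_pi_lambda _ fun n => h.measurable_A i n)

/-- Independence of the initial data from the paths allows the initial vector and the seed to be
frozen. -/
theorem lintegral_randomQueue (h : IsQueueingModel P p lam X₀ C A U) (π : Policy N K S) (t : ℕ)
    (V : (Fin N → ℕ) → ℝ≥0∞) :
    ∫⁻ ω, V (π.randomQueue X₀ C A U t ω) ∂P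
      = ∫⁻ ω, ∫⁻ ω', V (π.queue (U ω) (X₀ ω)
          (fun i n k => C i n k ω') (fun i n => A i n ω') t) ∂P ∂P := by
  have hI : Measurable fun ω => (X₀ ω, U ω) := h.measurable_X₀.prodMk h.measurable_U
  have hZ := h.measurable_paths
  have hF := (measurable_of_countable V).comp (π.measurable_queue t)
  refine (lintegral_map hF (hI.prodMk hZ)).symm.trans ?_
  rw [h.indep_init.map_prod_eq_prod_map_map hI.aemeasurable hZ.aemeasurable,
    lintegral_prod _ hF.aemeasurable, lintegral_map hF.lintegral_prod_right' hI]
  exact lintegral_congr fun ω => lintegral_map (hF.comp measurable_prodMk_left) hZ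

omit [IsProbabilityMeasure P] in
theorem measurable_randomQueue (h : IsQueueingModel P p lam X₀ C A U) (π : Policy N K S)
    (t : ℕ) : Measurable (π.randomQueue X₀ C A U t) := by
  have hI : Measurable fun ω => (X₀ ω, U ω) := h.measurable_X₀.prodMk h.measurable_U
  have hZ := h.measurable_paths
  exact (π.measurable_queue t).comp (hI.prodMk hZ)

theorem dominates_maxWeight (h : IsQueueingModel P p lam X₀ C A U) (π : Policy N K S) :
    Policy.Dominates P X₀ C A U (Policy.maxWeight N K S) π := by
  intro f hf t r
  let V : (Fin N → ℕ) → ℝ≥0∞ := fun x => {x | r < f x}.indicator 1 x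
  have hV : BalMono V := fun y x hyx => by
    have hle := hf y x (Relation.TransGen.single hyx)
    by_cases hy : r < f y
    · simp [V, hy, hy.trans_le hle]
    · simp [V, hy]
  have hmeas : ∀ π' : Policy N K S, P {ω | r < f (π'.randomQueue X₀ C A U (t + 1) ω)}
      = ∫⁻ ω, V (π'.randomQueue X₀ C A U (t + 1) ω) ∂P := by
    intro π'
    exact (lintegral_indicator_one (h.measurable_randomQueue π' (t + 1)
      (Set.to_countable {x | r < f x}).measurableSet)).symm
  rw [hmeas, hmeas, h.lintegral_randomQueue, h.lintegral_randomQueue]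
  exact lintegral_mono fun ω => h.lintegral_maxWeight_le π (U ω) (X₀ ω) (t + 1) hV

end IsQueueingModel

end Comparison

theorem theorem1 {Ω S : Type*} [MeasurableSpace Ω] [MeasurableSpace S]
    (P : Measure Ω) [IsProbabilityMeasure P] (N K : ℕ) (p lam : ℝ)
    (X₀ : Ω → Fin N → ℕ) (C : ℕ → Fin N → Fin K → Ω → Bool) (A : ℕ → Fin N → Ω → Bool)
    (U : Ω → S) (hmodel : IsQueueingModel P p lam X₀ C A U)
    (π : Policy N K S) (hπ : ¬ π.IsMWM) :
    ∃ πstar : Policy N K S, πstar.IsMWM ∧ Policy.Dominates P X₀ C A U πstar π :=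
  ⟨Policy.maxWeight N K S, Policy.isMWM_maxWeight, hmodel.dominates_maxWeight π⟩
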